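/- Let $\mathbb{D}=\{z\in\mathbb{C}:|z|<1\}$, $\alpha\ge 0$ and $0\le\beta<1$. Let $\mathcal{H}^0$ be the class of complex-valued harmonic functions $f$ in $\mathbb{D}$ with $f(0)=0$, $f_z(0)=1$ and $f_{\bar z}(0)=0$; every such $f$ has a unique representation $f=h+\overline{g}$ with $h,g$ analytic in $\mathbb{D}$ and $g(0)=0$. Let $\mathcal{W}_{\mathcal{H}}^0(\alpha,\beta)$ be the class of all $f=h+\overline{g}\in\mathcal{H}^0$ such that $$\operatorname{Re}\bigl(h'(z)+\alpha z h''(z)-\beta\bigr)>\bigl|g'(z)+\alpha z g''(z)\bigr|\qquad(z\in\mathbb{D}).$$ Then every $f\in\mathcal{W}_{\mathcal{H}}^0(\alpha,\beta)$ is close-to-convex in $\mathbb{D}$; that is, $f$ is univalent (injective) in $\mathbb{D}$ and the complement $\mathbb{C}\setminus f(\mathbb{D})$ is a union of pairwise disjoint closed half-lines. -/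

import Mathlib

open Complex Metric Set
open scoped ComplexConjugate

noncomputable section

/-- The open unit disk. -/
def unitDisk : Set ℂ := ball 0 1

/-- The Wirtinger derivative `f_z = (f_x - i f_y) / 2`. -/
def wirtingerZ (f : ℂ → ℂ) (z : ℂ) : ℂ :=
  (fderiv ℝ f z 1 - I * fderiv ℝ f z I) / 2

/-- The Wirtinger derivative `f_{z̄} = (f_x + i f_y) / 2`. -/
def wirtingerZBar (f : ℂ → ℂ) (z : ℂ) : ℂ :=
  (fderiv ℝ f z 1 + I * fderiv ℝ f z I) / 2

/-- Complex-valued harmonic functions `f` in the unit disk with `f(0) = f_z(0) - 1 = 0`.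
Values outside the disk play no role. -/
def classH : Set (ℂ → ℂ) :=
  {f | InnerProductSpace.HarmonicOnNhd f unitDisk ∧ f 0 = 0 ∧ wirtingerZ f 0 - 1 = 0}

/-- The members of `classH` with `f_{z̄}(0) = 0`. -/
def classH0 : Set (ℂ → ℂ) :=
  {f | f ∈ classH ∧ wirtingerZBar f 0 = 0}

/-- `f = h + conj g` in the unit disk, with `h` and `g` analytic there and `g(0) = 0`. -/
structure IsCanonicalRep (f h g : ℂ → ℂ) : Prop where
  analytic_h : AnalyticOnNhd ℂ h unitDisk
  analytic_g : AnalyticOnNhd ℂ g unitDisk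
  g_zero : g 0 = 0
  eq_add_conj : ∀ z ∈ unitDisk, f z = h z + conj (g z)

/-- The class `W_H^0(α, β)`. -/
def classWH0 (α β : ℝ) : Set (ℂ → ℂ) :=
  {f | f ∈ classH0 ∧ ∃ h g : ℂ → ℂ, IsCanonicalRep f h g ∧
    ∀ z ∈ unitDisk,
      ‖deriv g z + α * z * deriv (deriv g) z‖ <
        (deriv h z + α * z * deriv (deriv h) z - β).re}

/-- A (closed) half-line `{a + t b : t ≥ 0}`, `b ≠ 0`, of the plane. -/
def IsHalfLine (L : Set ℂ) : Prop :=
  ∃ a b : ℂ, b ≠ 0 ∧ L = {w | ∃ t : ℝ, 0 ≤ t ∧ w = a + t * b}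

/-- The complement of `Ω` is a union of pairwise non-intersecting half-lines. -/
def IsCloseToConvexRegion (Ω : Set ℂ) : Prop :=
  ∃ 𝓛 : Set (Set ℂ), (∀ L ∈ 𝓛, IsHalfLine L) ∧
    (∀ L ∈ 𝓛, ∀ M ∈ 𝓛, L ≠ M → Disjoint L M) ∧ ⋃₀ 𝓛 = Ωᶜ

/-- `f` is close-to-convex in the unit disk: it is univalent there, with a close-to-convex
image. -/
def IsCloseToConvex (f : ℂ → ℂ) : Prop :=
  InjOn f unitDisk ∧ IsCloseToConvexRegion (f '' unitDisk)

end

open Complex Metric Set Filter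
open scoped ComplexConjugate Topology

/-! The defining inequality forces |g'| < Re h' (`norm_deriv_lt_re_deriv`). On the convex disk this
makes `f` strictly monotone for the real inner product, hence injective.

For the complement, extend `f` to the multivalued map `monotoneValues` and restrict it to the closed
disk. There it takes every value, by compactness and a separation argument, and inside the disk it
reduces to `f`. So the omitted values are those taken over the unit circle. Fibres over distinct
circle points are disjoint, and the fibre over ζ is closed and stable under adding nonnegative
multiples of ζ, so it splits into half-lines of direction ζ. -/

/-- If `u + α r u'` is positive on `[0, 1]`, then so is `u` at `1`. -/
theorem pos_of_add_mul_deriv_pos {α : ℝ} (hα : 0 ≤ α) {u u' : ℝ → ℝ}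
    (hu : ∀ r ∈ Icc (0 : ℝ) 1, HasDerivAt u (u' r) r)
    (hpos : ∀ r ∈ Icc (0 : ℝ) 1, 0 < u r + α * r * u' r) : 0 < u 1 := by
  have hc : ContinuousOn u (Icc 0 1) := fun r hr => (hu r hr).continuousAt.continuousWithinAt
  obtain ⟨r, hr, hmin⟩ := isCompact_Icc.exists_isMinOn (nonempty_Icc.2 zero_le_one) hc
  refine lt_of_lt_of_le ?_ (hmin (right_mem_Icc.2 zero_le_one))
  have hfd := (hu r hr).hasDerivWithinAt (s := Icc 0 1) |>.hasFDerivWithinAt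
  -- Moving from the minimum point toward 0 stays in the interval, so r u'(r) ≤ 0 there.
  have hcone : (0 : ℝ) - r ∈ posTangentConeAt (Icc (0 : ℝ) 1) r :=
    sub_mem_posTangentConeAt_of_segment_subset
      ((convex_Icc 0 1).segment_subset hr (left_mem_Icc.2 zero_le_one))
  have hnn : 0 ≤ (0 - r) * u' r := by
    simpa using (hmin.localize).hasFDerivWithinAt_nonneg hfd hcone
  have := hpos r hr
  nlinarith [mul_nonneg hα hnn]

/-- The first-order part of the defining inequality of `classWH0` is implied by the whole. -/
theorem norm_deriv_lt_re_deriv {α β : ℝ} (hα : 0 ≤ α) (hβ : 0 ≤ β) {h g : ℂ → ℂ}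
    (hh : AnalyticOnNhd ℂ h unitDisk) (hg : AnalyticOnNhd ℂ g unitDisk)
    (hlt : ∀ z ∈ unitDisk, ‖deriv g z + α * z * deriv (deriv g) z‖ <
      (deriv h z + α * z * deriv (deriv h) z - β).re) {z : ℂ} (hz : z ∈ unitDisk) :
    ‖deriv g z‖ < (deriv h z).re := by
  -- This rotation makes Re(h' + ε g') equal to Re h' - |g'| at the endpoint `z` of the radius.
  obtain ⟨ε, hε, hεg⟩ : ∃ ε : ℂ, ‖ε‖ = 1 ∧ ε * deriv g z = -‖deriv g z‖ := by
    obtain ⟨c, hc, hcg⟩ := exists_norm_mul_eq_self (deriv g z)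
    have hc0 : c ≠ 0 := by rintro rfl; simp at hc
    refine ⟨-c⁻¹, by simp [hc], ?_⟩
    rw [← hcg]
    field_simp
    simp [hc]
  have hmem : ∀ r ∈ Icc (0 : ℝ) 1, (r : ℂ) * z ∈ unitDisk := by
    intro r hr
    simp only [unitDisk, mem_ball_zero_iff, norm_mul, norm_real, Real.norm_eq_abs,
      abs_of_nonneg hr.1] at hz ⊢
    nlinarith [norm_nonneg z, hr.2]
  have key := pos_of_add_mul_deriv_pos hα
    (u := fun r => (deriv h (r * z) + ε * deriv g (r * z)).re)
    (u' := fun r => ((deriv (deriv h) (r * z) + ε * deriv (deriv g) (r * z)) * z).re) ?_ ?_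
  · simp only [ofReal_one, one_mul, hεg] at key
    simp at key
    linarith
  · intro r hr
    have hl : HasDerivAt (fun s : ℂ => s * z) z (r : ℂ) := by
      simpa using (hasDerivAt_id (r : ℂ)).mul_const z
    have h1 := ((hh.deriv _ (hmem r hr)).differentiableAt.hasDerivAt).comp (r : ℂ) hl
    have h2 := ((hg.deriv _ (hmem r hr)).differentiableAt.hasDerivAt).comp (r : ℂ) hl
    have h3 := (h1.add (h2.const_mul ε)).real_of_complex
    convert h3 using 1
    congr 1
    ring_nf
  · intro r hr
    have h1 := hlt _ (hmem r hr)
    have h2 : -‖deriv g (r * z) + α * (r * z) * deriv (deriv g) (r * z)‖ ≤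
        (ε * (deriv g (r * z) + α * (r * z) * deriv (deriv g) (r * z))).re := by
      have := neg_le_of_abs_le
        (abs_re_le_norm (ε * (deriv g (r * z) + α * (r * z) * deriv (deriv g) (r * z))))
      rwa [norm_mul, hε, one_mul] at this
    have h3 : (deriv h (r * z) + ε * deriv g (r * z)).re +
        α * r * ((deriv (deriv h) (r * z) + ε * deriv (deriv g) (r * z)) * z).re =
        (deriv h (r * z) + α * (r * z) * deriv (deriv h) (r * z) - β).re + β +
        (ε * (deriv g (r * z) + α * (r * z) * deriv (deriv g) (r * z))).re := by
      simp only [add_re, sub_re, mul_re, mul_im, ofReal_re, ofReal_im, add_im]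
      ring
    simp only [h3]
    linarith

/-! ### Strict monotonicity -/

/-- `f` is strictly monotone on `s` for the real inner product of `ℂ`. -/
def StrictMonotoneField (f : ℂ → ℂ) (s : Set ℂ) : Prop :=
  ∀ z ∈ s, ∀ w ∈ s, z ≠ w → 0 < ((f z - f w) * conj (z - w)).re

theorem strictMonotoneField_of_norm_deriv_lt {f h g : ℂ → ℂ} {s : Set ℂ} (hs : Convex ℝ s)
    (hh : AnalyticOnNhd ℂ h s) (hg : AnalyticOnNhd ℂ g s)
    (hf : ∀ z ∈ s, f z = h z + conj (g z))
    (hlt : ∀ z ∈ s, ‖deriv g z‖ < (deriv h z).re) : StrictMonotoneField f s := by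
  intro z hz w hw hzw
  set v := z - w with hv
  have hv0 : v ≠ 0 := sub_ne_zero.2 hzw
  have hmem : ∀ t ∈ Icc (0 : ℝ) 1, w + (t : ℂ) * v ∈ s := by
    intro t ht
    have := hs.add_smul_sub_mem hw hz ht
    simpa [hv] using this
  -- Re(conj g · conj v) = Re(g · v), so the conjugate disappears and the function is the real part
  -- of an analytic one.
  have hd : ∀ t ∈ Icc (0 : ℝ) 1,
      HasDerivAt (fun t : ℝ => (h (w + t * v) * conj v + g (w + t * v) * v).re)
        (deriv h (w + t * v) * v * conj v + deriv g (w + t * v) * v * v).re t := by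
    intro t ht
    have hl : HasDerivAt (fun s : ℂ => w + s * v) v (t : ℂ) := by
      simpa using ((hasDerivAt_id (t : ℂ)).mul_const v).const_add w
    have h1 := ((hh _ (hmem t ht)).differentiableAt.hasDerivAt).comp (t : ℂ) hl
    have h2 := ((hg _ (hmem t ht)).differentiableAt.hasDerivAt).comp (t : ℂ) hl
    exact ((h1.mul_const (conj v)).add (h2.mul_const v)).real_of_complex
  have hmono : StrictMonoOn (fun t : ℝ => (h (w + t * v) * conj v + g (w + t * v) * v).re)
      (Icc 0 1) := by
    refine strictMonoOn_of_deriv_pos (convex_Icc 0 1)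
      (fun t ht => (hd t ht).continuousAt.continuousWithinAt) fun t ht => ?_
    have ht' := interior_subset ht
    rw [(hd t ht').deriv]
    have h1 := hlt _ (hmem t ht')
    have h2 := neg_le_of_abs_le (abs_re_le_norm (deriv g (w + t * v) * v * v))
    rw [norm_mul, norm_mul] at h2
    have h3 : (deriv h (w + t * v) * v * conj v).re = (deriv h (w + t * v)).re * (‖v‖ * ‖v‖) := by
      rw [mul_assoc, mul_conj, normSq_eq_norm_sq, re_mul_ofReal, sq]
    rw [add_re, h3]
    have : 0 < ‖v‖ * ‖v‖ := by positivity
    nlinarith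
  have h01 := hmono (left_mem_Icc.2 zero_le_one) (right_mem_Icc.2 zero_le_one) zero_lt_one
  have hz' : w + v = z := by simp [hv]
  simp only [ofReal_zero, zero_mul, add_zero, ofReal_one, one_mul, hz'] at h01
  rw [hf z hz, hf w hw]
  simp only [add_re, sub_re, mul_re, conj_re, conj_im, add_im, sub_im] at h01 ⊢
  linarith

theorem StrictMonotoneField.injOn {f : ℂ → ℂ} {s : Set ℂ} (hf : StrictMonotoneField f s) :
    InjOn f s := by
  intro z hz w hw hzw
  by_contra hne
  simpa [hzw] using hf z hz w hw hne

/-! ### A minimax lemma -/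

/-- A finite matrix with nonnegative symmetric part admits weights making all weighted row sums
nonnegative. -/
theorem exists_weights_nonneg {ι : Type*} [Fintype ι] [Nonempty ι] (a : ι → ι → ℝ)
    (ha : ∀ i j, 0 ≤ a i j + a j i) :
    ∃ c ∈ stdSimplex ℝ ι, ∀ i, 0 ≤ ∑ j, c j * a i j := by
  classical
  by_contra! hcon
  let A : (ι → ℝ) →ₗ[ℝ] (ι → ℝ) := (Matrix.of a).mulVecLin
  have hA : ∀ c i, A c i = ∑ j, c j * a i j := fun c i => by
    simp [A, Matrix.mulVec, dotProduct, mul_comm]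
  have hcpt : IsCompact (A '' stdSimplex ℝ ι) :=
    (isCompact_stdSimplex ℝ ι).image A.continuous_of_finiteDimensional
  have hdisj : Disjoint (A '' stdSimplex ℝ ι) (Ici 0) := by
    rw [Set.disjoint_left]
    rintro _ ⟨c, hc, rfl⟩ hpos
    obtain ⟨i, hi⟩ := hcon c hc
    have := hpos i
    rw [hA] at this
    exact absurd this (not_le.2 hi)
  obtain ⟨φ, u, v, hu, huv, hv⟩ := geometric_hahn_banach_compact_closed
    ((convex_stdSimplex ℝ ι).linear_image A) hcpt (convex_Ici 0) isClosed_Ici hdisj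
  have hv0 : v < 0 := by simpa using hv 0 (mem_Ici.2 le_rfl)
  set m : ι → ℝ := fun i => φ (Pi.single i 1) with hm
  have hφ : ∀ x, φ x = ∑ i, m i * x i := fun x => by
    conv_lhs => rw [pi_eq_sum_univ' x]
    simp [hm, mul_comm, map_sum]
  have hm0 : ∀ i, 0 ≤ m i := by
    intro i
    by_contra! hneg
    have h1 := hv ((v / m i) • Pi.single i 1) (by
      rw [mem_Ici]
      exact smul_nonneg (div_nonneg_of_nonpos hv0.le hneg.le) (by simp))
    rw [map_smul, smul_eq_mul] at h1
    change v < v / m i * m i at h1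
    rw [div_mul_cancel₀ _ hneg.ne] at h1
    exact lt_irrefl _ h1
  have hcol : ∀ j, ∑ i, m i * a i j < 0 := by
    intro j
    have h1 := hu _ ⟨Pi.single j 1, single_mem_stdSimplex ℝ j, rfl⟩
    rw [hφ] at h1
    simp only [hA, Pi.single_apply, ite_mul, one_mul, zero_mul, Finset.sum_ite_eq',
      Finset.mem_univ, if_true] at h1
    linarith
  -- The separating functional `m` is nonnegative with negative column sums, so its quadratic form
  -- is negative, against `ha`.
  have hsum : ∑ j, m j * ∑ i, m i * a i j < 0 := by
    have hle : ∀ j ∈ Finset.univ, m j * ∑ i, m i * a i j ≤ 0 := fun j _ =>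
      mul_nonpos_of_nonneg_of_nonpos (hm0 j) (hcol j).le
    refine Finset.sum_neg' hle ?_
    by_contra! hall
    have hz : ∀ j, m j = 0 := fun j => by
      by_contra hne
      exact absurd (hall j (Finset.mem_univ j))
        (not_le.2 (mul_neg_of_pos_of_neg ((hm0 j).lt_of_ne' hne) (hcol j)))
    obtain ⟨j⟩ := ‹Nonempty ι›
    simpa [hz] using hcol j
  have hswap : ∑ j, m j * ∑ i, m i * a i j = ∑ j, m j * ∑ i, m i * a j i := by
    simp only [Finset.mul_sum]
    rw [Finset.sum_comm]
    exact Finset.sum_congr rfl fun _ _ => Finset.sum_congr rfl fun _ _ => by ring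
  have hnn : 0 ≤ ∑ j, m j * ∑ i, m i * a i j + ∑ j, m j * ∑ i, m i * a j i := by
    rw [← Finset.sum_add_distrib]
    refine Finset.sum_nonneg fun j _ => ?_
    rw [← mul_add, ← Finset.sum_add_distrib]
    refine mul_nonneg (hm0 j) (Finset.sum_nonneg fun i _ => ?_)
    rw [← mul_add]
    exact mul_nonneg (hm0 i) (ha i j)
  linarith

/-! ### The multivalued extension -/

/-- The values at `ζ` of the maximal monotone extension of a monotone field on the unit disk. -/
def monotoneValues (f : ℂ → ℂ) (ζ : ℂ) : Set ℂ :=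
  {w | ∀ z ∈ unitDisk, 0 ≤ ((w - f z) * conj (ζ - z)).re}

/-- By monotonicity the matrix Re((w - f zᵢ) conj(zⱼ - zᵢ)) has nonnegative symmetric part; the
weights of `exists_weights_nonneg` average the zⱼ to ζ. -/
theorem exists_mem_monotoneValues_of_finset {f : ℂ → ℂ} (hf : StrictMonotoneField f unitDisk)
    (w : ℂ) (t : Finset unitDisk) :
    ∃ ζ ∈ closedBall (0 : ℂ) 1, ∀ z ∈ t, 0 ≤ ((w - f z) * conj (ζ - z)).re := by
  rcases t.eq_empty_or_nonempty with rfl | hne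
  · exact ⟨0, by simp, by simp⟩
  have : Nonempty t := hne.to_subtype
  obtain ⟨c, ⟨hc0, hc1⟩, hc⟩ := exists_weights_nonneg
    (fun i j : t => ((w - f i) * conj ((j : ℂ) - i)).re) (fun i j => by
      have h1 : 0 ≤ ((f i - f j) * conj ((i : ℂ) - j)).re := by
        rcases eq_or_ne (i : ℂ) j with h | h
        · simp [h]
        · exact (hf _ i.1.2 _ j.1.2 h).le
      simp only [mul_re, sub_re, sub_im, conj_re, conj_im] at h1 ⊢
      linarith)
  refine ⟨∑ j, c j • (j : ℂ), (convex_closedBall (0 : ℂ) 1).sum_mem (fun j _ => hc0 j) hc1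
    (fun j _ => ball_subset_closedBall j.1.2), fun z hz => ?_⟩
  have h1 := hc ⟨z, hz⟩
  have h2 : (∑ j, c j • (j : ℂ)) - z = ∑ j, c j • ((j : ℂ) - z) := by
    simp only [smul_sub, Finset.sum_sub_distrib, ← Finset.sum_smul, hc1, one_smul]
  rw [h2, map_sum, Finset.mul_sum, re_sum]
  convert h1 using 2 with j
  simp [mul_re]
  ring

theorem exists_mem_monotoneValues {f : ℂ → ℂ} (hf : StrictMonotoneField f unitDisk) (w : ℂ) :
    ∃ ζ ∈ closedBall (0 : ℂ) 1, w ∈ monotoneValues f ζ := by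
  obtain ⟨ζ, hζ, hmem⟩ := (isCompact_closedBall (0 : ℂ) 1).inter_iInter_nonempty
    (fun z : unitDisk => {ζ : ℂ | 0 ≤ ((w - f z) * conj (ζ - z)).re})
    (fun z => isClosed_le continuous_const (by fun_prop)) (fun t => by
      obtain ⟨ζ, hζ, h⟩ := exists_mem_monotoneValues_of_finset hf w t
      exact ⟨ζ, hζ, mem_iInter₂.2 h⟩)
  exact ⟨ζ, hζ, fun z hz => mem_iInter.1 hmem ⟨z, hz⟩⟩

/-- At a point of continuity in the disk, the only value is that of the field itself. -/
theorem eq_of_mem_monotoneValues {f : ℂ → ℂ} {ζ w : ℂ} (hζ : ζ ∈ unitDisk)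
    (hc : ContinuousAt f ζ) (hw : w ∈ monotoneValues f ζ) : w = f ζ := by
  -- Minty's trick: testing at ζ + t v as t → 0⁺ gives |v|² ≤ 0.
  set v := w - f ζ with hv
  have hline : Tendsto (fun t : ℝ => ζ + (t : ℂ) * v) (𝓝[>] 0) (𝓝 ζ) := by
    have : ContinuousAt (fun t : ℝ => ζ + (t : ℂ) * v) 0 := by fun_prop
    simpa using this.tendsto.mono_left nhdsWithin_le_nhds
  have hlim : Tendsto (fun t : ℝ => ((w - f (ζ + (t : ℂ) * v)) * conj v).re) (𝓝[>] 0)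
      (𝓝 ((w - f ζ) * conj v).re) :=
    (continuous_re.tendsto _).comp
      ((tendsto_const_nhds.sub (hc.tendsto.comp hline)).mul_const (conj v))
  have hle : ((w - f ζ) * conj v).re ≤ 0 := by
    refine le_of_tendsto hlim ?_
    filter_upwards [hline.eventually (isOpen_ball.mem_nhds hζ), self_mem_nhdsWithin]
      with t ht ht0
    have h1 := hw _ ht
    have h2 : (w - f (ζ + t * v)) * conj (ζ - (ζ + t * v)) =
        ((-t : ℝ) : ℂ) * ((w - f (ζ + t * v)) * conj v) := by
      simp
      ring
    rw [h2, re_ofReal_mul] at h1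
    have : (0 : ℝ) < t := ht0
    nlinarith
  rw [← hv, mul_conj, ofReal_re] at hle
  exact sub_eq_zero.1 (normSq_eq_zero.1 (le_antisymm hle (normSq_nonneg _)))

theorem disjoint_monotoneValues_image {f : ℂ → ℂ} (hf : StrictMonotoneField f unitDisk) {ζ : ℂ}
    (hζ : ζ ∈ sphere (0 : ℂ) 1) : Disjoint (monotoneValues f ζ) (f '' unitDisk) := by
  rw [Set.disjoint_left]
  rintro _ hw ⟨z, hz, rfl⟩
  have hne : ζ ≠ z := by
    rintro rfl
    simp_all [unitDisk]
  -- At the midpoint, ζ - m = m - z, so the two monotonicity inequalities contradict each other.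
  have hm : z + (1 / 2 : ℝ) • (ζ - z) ∈ unitDisk := by
    have := (convex_closedBall (0 : ℂ) 1).add_smul_sub_mem_interior' (x := ζ) (y := z)
      (by simpa using sphere_subset_closedBall hζ) (by simpa [interior_closedBall, unitDisk] using hz)
      (t := 1 / 2) (by norm_num)
    rw [interior_closedBall _ one_ne_zero] at this
    have e : z + (1 / 2 : ℝ) • (ζ - z) = ζ + (1 / 2 : ℝ) • (z - ζ) := by module
    exact e ▸ this
  set m := z + (1 / 2 : ℝ) • (ζ - z) with hmdef
  have h1 := hw m hm
  have h2 := hf m hm z hz (by simpa [hmdef, sub_eq_zero] using hne)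
  have e1 : ζ - m = (1 / 2 : ℝ) * (ζ - z) := by simp [hmdef]; ring
  have e2 : m - z = (1 / 2 : ℝ) * (ζ - z) := by simp [hmdef]
  rw [e1] at h1
  rw [e2] at h2
  simp only [mul_re, sub_re, sub_im, conj_re, conj_im] at h1 h2
  linarith

/-- A common value would make the component of `f` along the open chord constant, against strict
monotonicity. -/
theorem disjoint_monotoneValues {f : ℂ → ℂ} (hf : StrictMonotoneField f unitDisk) {ζ ξ : ℂ}
    (hζ : ζ ∈ sphere (0 : ℂ) 1) (hξ : ξ ∈ sphere (0 : ℂ) 1) (hne : ζ ≠ ξ) :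
    Disjoint (monotoneValues f ζ) (monotoneValues f ξ) := by
  rw [Set.disjoint_left]
  intro w hw hw'
  have hmem : ∀ t ∈ Ioo (0 : ℝ) 1, ξ + (t : ℂ) * (ζ - ξ) ∈ unitDisk := by
    intro t ht
    have := strictConvex_closedBall ℝ (0 : ℂ) 1 (sphere_subset_closedBall hξ)
      (sphere_subset_closedBall hζ) hne.symm (sub_pos.2 ht.2) ht.1 (by ring)
    rw [interior_closedBall _ one_ne_zero] at this
    have e : ξ + (t : ℂ) * (ζ - ξ) = (1 - t) • ξ + t • ζ := by
      simp only [real_smul]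
      push_cast
      ring
    exact e ▸ this
  have hzero : ∀ t ∈ Ioo (0 : ℝ) 1, ((w - f (ξ + t * (ζ - ξ))) * conj (ζ - ξ)).re = 0 := by
    intro t ht
    have h1 := hw _ (hmem t ht)
    have h2 := hw' _ (hmem t ht)
    have e1 : (w - f (ξ + t * (ζ - ξ))) * conj (ζ - (ξ + t * (ζ - ξ))) =
        ((1 - t : ℝ) : ℂ) * ((w - f (ξ + t * (ζ - ξ))) * conj (ζ - ξ)) := by
      simp
      ring
    have e2 : (w - f (ξ + t * (ζ - ξ))) * conj (ξ - (ξ + t * (ζ - ξ))) =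
        ((-t : ℝ) : ℂ) * ((w - f (ξ + t * (ζ - ξ))) * conj (ζ - ξ)) := by
      simp
      ring
    rw [e1, re_ofReal_mul] at h1
    rw [e2, re_ofReal_mul] at h2
    nlinarith [ht.1, ht.2]
  have ha : (1 / 2 : ℝ) ∈ Ioo (0 : ℝ) 1 := by norm_num
  have hb : (1 / 3 : ℝ) ∈ Ioo (0 : ℝ) 1 := by norm_num
  have h3 := hf _ (hmem _ ha) _ (hmem _ hb) (by
    intro h
    have h4 := mul_right_cancel₀ (sub_ne_zero.2 hne) (add_left_cancel h)
    rw [ofReal_inj] at h4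
    norm_num at h4)
  have e3 : ξ + ((1 / 2 : ℝ) : ℂ) * (ζ - ξ) - (ξ + ((1 / 3 : ℝ) : ℂ) * (ζ - ξ)) =
      ((1 / 6 : ℝ) : ℂ) * (ζ - ξ) := by
    push_cast
    ring
  have h4 := hzero _ ha
  have h5 := hzero _ hb
  rw [e3] at h3
  simp only [map_mul, conj_ofReal, mul_re, mul_im, sub_re, sub_im, conj_re, conj_im, ofReal_re,
    ofReal_im] at h3 h4 h5
  linarith

/-! ### Half-lines in the complement -/

/-- The values at a point of the unit circle split into half-lines in the radial direction. -/
theorem exists_radial_halfLine {f : ℂ → ℂ} {ζ w : ℂ} (hζ : ζ ∈ sphere (0 : ℂ) 1)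
    (hw : w ∈ monotoneValues f ζ) :
    ∃ a : ℂ, (∃ t : ℝ, a = w + t * ζ) ∧
      ∀ s : ℝ, a + s * ζ ∈ monotoneValues f ζ ↔ 0 ≤ s := by
  have hζ1 : ζ * conj ζ = 1 := by simp_all [mul_conj, normSq_eq_norm_sq]
  have hpos : ∀ z ∈ unitDisk, 0 < (ζ * conj (ζ - z)).re := by
    intro z hz
    have h1 := re_le_norm (ζ * conj z)
    simp only [norm_mul, RCLike.norm_conj, mem_sphere_zero_iff_norm.1 hζ, one_mul] at h1
    have h2 : ‖z‖ < 1 := by simpa [unitDisk] using hz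
    rw [map_sub, mul_sub, hζ1, sub_re, one_re]
    linarith
  have hadd : ∀ (x z : ℂ) (t : ℝ), ((x + t * ζ - f z) * conj (ζ - z)).re =
      ((x - f z) * conj (ζ - z)).re + t * (ζ * conj (ζ - z)).re := by
    intro x z t
    rw [← re_ofReal_mul, ← add_re]
    ring_nf
  set S : Set ℝ := {t | w + t * ζ ∈ monotoneValues f ζ} with hS
  have hclosed : IsClosed S := by
    have : S = ⋂ z ∈ unitDisk, {t : ℝ | 0 ≤ ((w + t * ζ - f z) * conj (ζ - z)).re} := by
      ext t
      simp [hS, monotoneValues]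
    rw [this]
    exact isClosed_biInter fun z _ => isClosed_le continuous_const (by fun_prop)
  have hne : S.Nonempty := ⟨0, by simpa [hS] using hw⟩
  have hbdd : BddBelow S := by
    -- Testing at the centre `z = 0` bounds `t` from below.
    refine ⟨-((w - f 0) * conj ζ).re, fun t ht => ?_⟩
    have h1 := ht 0 (by simp [unitDisk])
    rw [hadd, sub_zero, hζ1, one_re] at h1
    linarith
  refine ⟨w + (sInf S : ℝ) * ζ, ⟨_, rfl⟩, fun s => ⟨fun hs => ?_, fun hs z hz => ?_⟩⟩
  · have : sInf S + s ∈ S := by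
      simp only [hS, mem_ofPred_eq]
      convert hs using 1
      push_cast
      ring
    linarith [csInf_le hbdd this]
  · rw [hadd]
    exact add_nonneg (hclosed.csInf_mem hne hbdd z hz) (mul_nonneg hs (hpos z hz).le)

/-- The complement of the image of the disk under a continuous strictly monotone field is a
disjoint union of half-lines. -/
theorem StrictMonotoneField.isCloseToConvexRegion {f : ℂ → ℂ}
    (hf : StrictMonotoneField f unitDisk) (hc : ∀ z ∈ unitDisk, ContinuousAt f z) :
    IsCloseToConvexRegion (f '' unitDisk) := by
  refine ⟨{L | ∃ ζ ∈ sphere (0 : ℂ) 1, ∃ w ∈ monotoneValues f ζ,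
    L = {x | x ∈ monotoneValues f ζ ∧ ∃ t : ℝ, x = w + t * ζ}}, ?_, ?_, ?_⟩
  · rintro _ ⟨ζ, hζ, w, hw, rfl⟩
    obtain ⟨a, ⟨t, rfl⟩, ha⟩ := exists_radial_halfLine hζ hw
    refine ⟨w + t * ζ, ζ, by rintro rfl; simp at hζ, ?_⟩
    ext x
    constructor
    · rintro ⟨hx, s, rfl⟩
      have e : w + s * ζ = w + t * ζ + (s - t : ℝ) * ζ := by
        push_cast
        ring
      exact ⟨s - t, (ha _).1 (e ▸ hx), e⟩
    · rintro ⟨s, hs, rfl⟩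
      refine ⟨(ha s).2 hs, t + s, ?_⟩
      push_cast
      ring
  · rintro _ ⟨ζ, hζ, w, -, rfl⟩ _ ⟨ξ, hξ, y, -, rfl⟩ hne
    rcases eq_or_ne ζ ξ with rfl | h
    · rw [Set.disjoint_left]
      rintro x ⟨-, t, ht⟩ ⟨-, s, hs⟩
      refine hne ?_
      ext q
      refine and_congr_right fun _ => ⟨?_, ?_⟩
      · rintro ⟨r, rfl⟩
        refine ⟨r - t + s, ?_⟩
        push_cast
        linear_combination hs - ht
      · rintro ⟨r, rfl⟩
        refine ⟨r - s + t, ?_⟩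
        push_cast
        linear_combination ht - hs
    · exact (disjoint_monotoneValues hf hζ hξ h).mono (fun _ hx => hx.1) fun _ hx => hx.1
  · ext x
    constructor
    · rintro ⟨_, ⟨ζ, hζ, w, -, rfl⟩, hx, -⟩
      exact Set.disjoint_left.1 (disjoint_monotoneValues_image hf hζ) hx
    · intro hx
      obtain ⟨ζ, hζ, hmem⟩ := exists_mem_monotoneValues hf x
      have hζ' : ζ ∈ sphere (0 : ℂ) 1 := by
        rw [← closedBall_sdiff_ball]
        refine ⟨hζ, fun hin => hx ⟨ζ, hin, ?_⟩⟩
        exact (eq_of_mem_monotoneValues hin (hc ζ hin) hmem).symm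
      exact ⟨_, ⟨ζ, hζ', x, hmem, rfl⟩, hmem, 0, by simp⟩

theorem mainTheorem1 (α β : ℝ) (hα : 0 ≤ α) (hβ₀ : 0 ≤ β) (hβ₁ : β < 1)
    (f : ℂ → ℂ) (hf : f ∈ classWH0 α β) : IsCloseToConvex f := by
  obtain ⟨⟨⟨hharm, -, -⟩, -⟩, h, g, hrep, hlt⟩ := hf
  have hmono : StrictMonotoneField f unitDisk :=
    strictMonotoneField_of_norm_deriv_lt (convex_ball 0 1) hrep.analytic_h hrep.analytic_g
      hrep.eq_add_conj fun z hz =>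
        norm_deriv_lt_re_deriv hα hβ₀ hrep.analytic_h hrep.analytic_g hlt hz
  exact ⟨hmono.injOn, hmono.isCloseToConvexRegion fun z hz => (hharm z hz).1.continuousAt⟩
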